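/- For each $n$ let $G_n$ be a simple graph on the vertex set $V=\{1,\dots,n\}$, let $\delta_v$ be the degree of $v$, and for $S\subseteq V$ let $\mathrm{vol}(S)=\sum_{v\in S}\delta_v$. Let $p\in[0,1]$ and $k\in\mathbb N$. In the $(k,p,\mathcal B)$-Node-Majority dynamics on $G_n$ every node is in state $\mathcal R$ at round $0$. In each round, simultaneously and with independent random choices, every node samples $k$ of its neighbours uniformly at random with replacement. With probability $p$, independently of the sample, the node moves to state $\mathcal B$; otherwise it moves to the state held by the majority of its sample (counted with multiplicity) in the previous round, ties being broken by a fair coin. Let $B^{(t)}$ be the set of nodes in state $\mathcal B$ at round $t$, let $\mathbf P_k=\mathbf P_k^{(n)}$ be the law of the process, and let $$\tau=\inf\Big\{t\ge 0:\ \frac{\mathrm{vol}(B^{(t)})}{\mathrm{vol}(V)}>\frac12\Big\}\in\mathbb N_0\cup\{\infty\}.$$ **Proposition.** For every $p\in[0,1]$ and every $\gamma>0$ there exists $H=H(p,\gamma)$ such that the following holds for every sequence of graphs $(G_n)_{n\in\mathbb N}$ as above with $\min_{v\in V}\delta_v=\omega(\log n)$. - *Fast disruption.* If $p>\frac12$,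 then for all $k>H$, as $n\to\infty$, $$\mathbf P_k(\tau=1)=1-o(1)\qquad\text{and}\qquad \mathbf P_k\Big(\frac{\mathrm{vol}(B^{(2)})}{\mathrm{vol}(V)}\ge 1-\gamma\Big)=1-o(1).$$ - *Slow disruption.* If $p<\frac12$, then for all $k>H$ and all real $K>0$, as $n\to\infty$, $$\mathbf P_k(\tau>n^K)=1-o(1).$$ -/

import Mathlib

open MeasureTheory ProbabilityTheory Filter Topology
open scoped ENNReal

namespace NodeMajority

/-- The two possible states of a node. -/
inductive NodeState where
  | red : NodeState
  | blue : NodeState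
  deriving DecidableEq

/-- A configuration assigns a state to each of the `n` nodes. -/
abbrev Config (n : ℕ) : Type := Fin n → NodeState

/-- The random choices of one node in one round: the `k` sampled nodes (with replacement), whether
the external agent corrupts the node, and the fair coin that is used to break ties. -/
abbrev Choices (n k : ℕ) : Type := (Fin k → Fin n) × Bool × Bool

/-- The state of a node after one round of the dynamics, given the current configuration `x` and the
random choices `c` of the node. A sampled node counts with its multiplicity in the sample. -/
def updateState {n k : ℕ} (x : Config n) (c : Choices n k) : NodeState :=
  let reds := (Finset.univ.filter fun i : Fin k => x (c.1 i) = NodeState.red).card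
  let blues := (Finset.univ.filter fun i : Fin k => x (c.1 i) = NodeState.blue).card
  if c.2.1 = true ∨ reds < blues then NodeState.blue
  else if blues < reds then NodeState.red
  else if c.2.2 = true then NodeState.red
  else NodeState.blue

/-- The configuration at each round, from the initial configuration `x₀` and the random choices
`ω (t, u)` that determine the update of node `u` from round `t` to round `t + 1`. -/
def config {n k : ℕ} (x₀ : Config n) (ω : ℕ × Fin n → Choices n k) : ℕ → Config n
  | 0 => x₀
  | t + 1 => fun u => updateState (config x₀ ω t) (ω (t, u))

/-- A uniformly random neighbour of `u`. An isolated node, which has no neighbour to sample, samples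
itself. -/
noncomputable def neighborPMF {n : ℕ} (G : SimpleGraph (Fin n)) [DecidableRel G.Adj] (u : Fin n) :
    PMF (Fin n) :=
  if h : (G.neighborFinset u).Nonempty then PMF.uniformOfFinset (G.neighborFinset u) h
  else PMF.pure u

/-- The law of the random choices of the node `u` in one round: `k` independent uniform neighbours,
an independent corruption with probability `p`, and an independent fair coin. -/
noncomputable def choicesLaw {n : ℕ} (G : SimpleGraph (Fin n)) [DecidableRel G.Adj] (k : ℕ)
    (p : unitInterval) (u : Fin n) : Measure (Choices n k) :=
  (Measure.pi fun _ : Fin k => (neighborPMF G u).toMeasure).prod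
    ((bernoulliMeasure true false p).prod (bernoulliMeasure true false ⟨1 / 2, by norm_num, by norm_num⟩))

instance {n : ℕ} (G : SimpleGraph (Fin n)) [DecidableRel G.Adj] (k : ℕ) (p : unitInterval)
    (u : Fin n) : IsProbabilityMeasure (choicesLaw G k p u) := by
  unfold choicesLaw
  infer_instance

/-- The probability space that drives the dynamics with sample size `k` and bias `p` on `G`: the
choices of all nodes in all rounds are independent. -/
noncomputable def law {n : ℕ} (G : SimpleGraph (Fin n)) [DecidableRel G.Adj] (k : ℕ)
    (p : unitInterval) : Measure (ℕ × Fin n → Choices n k) :=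
  Measure.infinitePi fun i : ℕ × Fin n => choicesLaw G k p i.2

/-- The volume of a set of nodes: the sum of their degrees. -/
def vol {n : ℕ} (G : SimpleGraph (Fin n)) [DecidableRel G.Adj] (S : Finset (Fin n)) : ℕ :=
  ∑ v ∈ S, G.degree v

/-- The set of nodes in state `blue`. -/
def blueSet {n : ℕ} (x : Config n) : Finset (Fin n) :=
  Finset.univ.filter fun u => x u = NodeState.blue

/-- The fraction of the volume of the graph that is in state `blue`. -/
noncomputable def blueFraction {n : ℕ} (G : SimpleGraph (Fin n)) [DecidableRel G.Adj]
    (x : Config n) : ℝ :=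
  (vol G (blueSet x) : ℝ) / (vol G Finset.univ : ℝ)

/-- The time of disruption of a trajectory: the first round in which more than half of the volume is
in state `blue`, and `⊤` if there is no such round. -/
noncomputable def disruptionTime {n : ℕ} (G : SimpleGraph (Fin n)) [DecidableRel G.Adj]
    (x : ℕ → Config n) : ℕ∞ :=
  ⨅ (t : ℕ) (_ : 1 / 2 < blueFraction G (x t)), (t : ℕ∞)

/-- The configuration in which every node is in state `red`. -/
def allRed (n : ℕ) : Config n := fun _ => NodeState.red

/-- The minimum degree of `G n` grows faster than `log n`. -/
def SufficientlyDense (G : (n : ℕ) → SimpleGraph (Fin n)) [∀ n, DecidableRel (G n).Adj] : Prop :=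
  (fun n : ℕ => Real.log n) =o[atTop] fun n : ℕ => ((G n).minDegree : ℝ)

end NodeMajority

/-! The quantity to follow is local: `FewNeighbors` bounds the fraction of nodes in state `s` inside
every single neighbourhood. It controls the law of each node's sample, and double counting
(`vol_filter_eq_sum`) turns it into a bound on volume.

If every neighbourhood has at most a fraction `β < 1/2` in state `s`, Hoeffding over the `k` samples
shows that at least half of a sample is in state `s` with probability at most `exp (-2 (1/2 - β)²
k)`. So a node becomes red with at most this probability, and blue with at most this plus `p`. For a
fixed current configuration the updates are independent, so Hoeffding over each neighbourhood and a
union bound over nodes (`law_not_fewNeighbors_update_le`) carry such a bound to the next round, with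
slack `ε` and error `n exp (-2 ε² δ_min)`. This error beats every power of `n` because `δ_min =
ω(log n)`. The Markov property `law_config_mem_inter_le` replaces the fixed configuration by the
random one.

If `p > 1/2`, the first round makes red a local minority, and a second round with `k` large makes it
negligible. If `p < 1/2`, the midpoint `β` of `p` and `1/2` is a self-reproducing bound on the blue
fraction, and a union bound over `n ^ K` rounds suffices. -/

namespace NodeMajority

/-- **Hoeffding's inequality** for independent random variables with values in `[0, 1]` whose means
are at most `q`. -/
lemma measure_le_sum_le_exp {ι Ω : Type*} [MeasurableSpace Ω] {μ : Measure Ω}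
    [IsProbabilityMeasure μ] {X : ι → Ω → ℝ} (hX : iIndepFun X μ) (hm : ∀ i, Measurable (X i))
    (h01 : ∀ i ω, X i ω ∈ Set.Icc (0 : ℝ) 1) (s : Finset ι) {q ε : ℝ}
    (hq : ∀ i ∈ s, μ[X i] ≤ q) (hε : 0 ≤ ε) :
    μ {ω | (q + ε) * s.card ≤ ∑ i ∈ s, X i ω} ≤
      ENNReal.ofReal (Real.exp (-2 * ε ^ 2 * s.card)) := by
  rcases s.eq_empty_or_nonempty with rfl | hs
  · simp
  have hc : (0 : ℝ) < s.card := by exact_mod_cast hs.card_pos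
  have hind : iIndepFun (fun i ω => X i ω - μ[X i]) μ :=
    hX.comp (fun i x => x - ∫ ω, X i ω ∂μ) fun i => measurable_id.sub_const _
  -- A centred variable with values in an interval of length 1 has variance proxy `1/4`; this gives
  -- the factor 2 in the exponent.
  have hoeff := HasSubgaussianMGF.measure_sum_ge_le_of_iIndepFun hind (s := s)
    (c := fun _ => (‖(1 : ℝ) - 0‖₊ / 2) ^ 2)
    (fun i _ => hasSubgaussianMGF_of_mem_Icc (hm i).aemeasurable (ae_of_all _ (h01 i)))
    (ε := ε * s.card) (by positivity)
  refine (measure_mono (t := {ω | ε * s.card ≤ ∑ i ∈ s, (X i ω - μ[X i])}) ?_).trans ?_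
  · intro ω hω
    have hsum : ∑ i ∈ s, μ[X i] ≤ q * s.card := by
      simpa [mul_comm] using Finset.sum_le_sum hq
    simp only [Set.mem_ofPred_eq, Finset.sum_sub_distrib] at hω ⊢
    linarith
  · rw [← ofReal_measureReal (measure_ne_top μ _)]
    refine ENNReal.ofReal_le_ofReal (hoeff.trans (Real.exp_le_exp.2 (le_of_eq ?_)))
    simp
    field_simp

/-- Every node has at most a fraction `β` of its neighbours in state `s`. -/
def FewNeighbors {n : ℕ} (G : SimpleGraph (Fin n)) [DecidableRel G.Adj] (x : Config n)
    (s : NodeState) (β : ℝ) : Prop :=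
  ∀ u, (((G.neighborFinset u).filter fun v => x v = s).card : ℝ) ≤ β * G.degree u

/-! ### From neighbourhood fractions to volume. -/

section Graph

variable {n : ℕ} (G : SimpleGraph (Fin n)) [DecidableRel G.Adj]

/-- Double counting: both sides count the ordered adjacent pairs with one prescribed endpoint in
state `s`. -/
lemma vol_filter_eq_sum (x : Config n) (s : NodeState) :
    vol G (Finset.univ.filter fun u => x u = s) =
      ∑ u, ((G.neighborFinset u).filter fun v => x v = s).card := by
  simp only [vol, ← SimpleGraph.card_neighborFinset_eq_degree,
    Finset.card_eq_sum_ones, Finset.sum_filter, SimpleGraph.neighborFinset_eq_filter]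
  rw [Finset.sum_comm' (t' := Finset.univ) (s' := fun _ => Finset.univ) (by simp)]
  refine Finset.sum_congr rfl fun u _ => ?_
  by_cases h : x u = s <;> simp [h, G.adj_comm]

variable {G}

lemma FewNeighbors.vol_le {x : Config n} {s : NodeState} {β : ℝ} (h : FewNeighbors G x s β) :
    (vol G (Finset.univ.filter fun u => x u = s) : ℝ) ≤ β * vol G Finset.univ := by
  rw [vol_filter_eq_sum, vol]
  push_cast
  rw [Finset.mul_sum]
  exact Finset.sum_le_sum fun u _ => h u

variable (G) in
lemma vol_red_add_vol_blue (x : Config n) :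
    vol G (Finset.univ.filter fun u => x u = NodeState.red) + vol G (blueSet x) =
      vol G Finset.univ := by
  have hb : blueSet x = Finset.univ.filter fun u => ¬ x u = NodeState.red := by
    ext u
    cases h : x u <;> simp [blueSet, h]
  rw [hb]
  exact Finset.sum_filter_add_sum_filter_not _ _ _

lemma FewNeighbors.blueFraction_le {x : Config n} {β : ℝ} (hβ : 0 ≤ β)
    (h : FewNeighbors G x NodeState.blue β) : blueFraction G x ≤ β :=
  div_le_of_le_mul₀ (by positivity) hβ h.vol_le

/-- Positive volume matters: in an edgeless graph the blue fraction is `0 / 0 = 0`, while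
`FewNeighbors` holds for every `β`. -/
lemma FewNeighbors.le_blueFraction {x : Config n} {β : ℝ} (hG : 0 < vol G Finset.univ)
    (h : FewNeighbors G x NodeState.red β) : 1 - β ≤ blueFraction G x := by
  have hG' : (0 : ℝ) < vol G Finset.univ := by exact_mod_cast hG
  have hsum : ((vol G (Finset.univ.filter fun u => x u = NodeState.red) : ℕ) : ℝ) +
      vol G (blueSet x) = vol G Finset.univ := by exact_mod_cast vol_red_add_vol_blue G x
  rw [blueFraction, le_div_iff₀ hG']
  linarith [h.vol_le]

lemma vol_univ_pos (hn : 0 < n) (hG : 0 < G.minDegree) : 0 < vol G Finset.univ :=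
  Finset.sum_pos (fun v _ => hG.trans_le (G.minDegree_le_degree v)) ⟨⟨0, hn⟩, Finset.mem_univ _⟩

lemma fewNeighbors_allRed_blue {β : ℝ} (hβ : 0 ≤ β) :
    FewNeighbors G (allRed n) NodeState.blue β := fun u => by
  simp only [allRed, reduceCtorEq, Finset.filter_false, Finset.card_empty, Nat.cast_zero]
  positivity

lemma blueFraction_allRed : blueFraction G (allRed n) = 0 := by
  simp [blueFraction, blueSet, allRed, vol]

end Graph

/-! ### The update of a single node. -/

section Sample

variable {n : ℕ} {G : SimpleGraph (Fin n)} [DecidableRel G.Adj]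

lemma neighborPMF_toMeasure_le {x : Config n} {s : NodeState} {β : ℝ} {u : Fin n}
    (h : FewNeighbors G x s β) (hu : 0 < G.degree u) :
    (neighborPMF G u).toMeasure.real {v | x v = s} ≤ β := by
  have hne : (G.neighborFinset u).Nonempty := by
    rwa [← Finset.card_pos, SimpleGraph.card_neighborFinset_eq_degree]
  have hu' : (0 : ℝ) < G.degree u := by exact_mod_cast hu
  rw [measureReal_def, neighborPMF, dif_pos hne,
    PMF.toMeasure_uniformOfFinset_apply _ _ (Set.toFinite _).measurableSet, ENNReal.toReal_div,
    ENNReal.toReal_natCast, ENNReal.toReal_natCast, SimpleGraph.card_neighborFinset_eq_degree,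
    div_le_iff₀ hu']
  simpa using h u

/-- A node whose neighbours are in state `s` with frequency at most `β < 1 / 2` is unlikely to
sample at least half of the time a neighbour in state `s`. -/
lemma pi_neighborPMF_half_le (k : ℕ) {x : Config n} {s : NodeState} {β : ℝ} {u : Fin n}
    (h : FewNeighbors G x s β) (hβ : β ≤ 1 / 2) (hu : 0 < G.degree u) :
    (Measure.pi fun _ : Fin k => (neighborPMF G u).toMeasure)
        {c | (k : ℝ) ≤ 2 * (Finset.univ.filter fun i => x (c i) = s).card} ≤
      ENNReal.ofReal (Real.exp (-2 * (1 / 2 - β) ^ 2 * k)) := by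
  set f : Fin n → ℝ := Set.indicator {v | x v = s} 1 with hf
  -- With `ε = 1/2 - β` the threshold `q + ε` is exactly `1/2`.
  have key := measure_le_sum_le_exp (μ := Measure.pi fun _ : Fin k => (neighborPMF G u).toMeasure)
    (X := fun i c => f (c i)) (iIndepFun_pi fun i => (measurable_of_finite f).aemeasurable)
    (fun i => (measurable_of_finite f).comp (measurable_pi_apply i))
    (fun i c => by by_cases hc : x (c i) = s <;> simp [hf, hc]) Finset.univ (q := β)
    (ε := 1 / 2 - β) (fun i _ => by
      have := (measurePreserving_eval (fun _ : Fin k => (neighborPMF G u).toMeasure) i).map_eq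
      have h2 := integral_map (μ := Measure.pi fun _ : Fin k => (neighborPMF G u).toMeasure)
        (measurable_pi_apply i).aemeasurable
        (measurable_of_finite f).aestronglyMeasurable (f := f)
      change ∫ c : Fin k → Fin n, f (c i) ∂_ ≤ β
      rw [← h2]
      change ∫ y, f y ∂(Measure.map (Function.eval i)
        (Measure.pi fun _ : Fin k => (neighborPMF G u).toMeasure)) ≤ β
      rw [this, hf, integral_indicator_one (Set.toFinite _).measurableSet]
      exact neighborPMF_toMeasure_le h hu)
    (by linarith)
  refine (measure_mono ?_).trans (by simpa using key)
  intro c hc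
  simp only [Set.mem_ofPred_eq] at hc ⊢
  have : ∑ i, f (c i) = (Finset.univ.filter fun i => x (c i) = s).card := by
    simp [hf, Set.indicator_apply]
  rw [this]
  simp
  linarith

lemma choicesLaw_fst (k : ℕ) (p : unitInterval) (u : Fin n) (A : Set (Fin k → Fin n)) :
    choicesLaw G k p u {c | c.1 ∈ A} =
      (Measure.pi fun _ : Fin k => (neighborPMF G u).toMeasure) A :=
  (measurePreserving_fst (μ := Measure.pi fun _ : Fin k => (neighborPMF G u).toMeasure)
    (ν := (bernoulliMeasure true false p).prod
      (bernoulliMeasure true false ⟨1 / 2, by norm_num, by norm_num⟩))).measure_preimage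
    (Set.toFinite A).measurableSet.nullMeasurableSet

lemma choicesLaw_corruption (k : ℕ) (p : unitInterval) (u : Fin n) (A : Set Bool) :
    choicesLaw G k p u {c | c.2.1 ∈ A} = bernoulliMeasure true false p A :=
  ((measurePreserving_fst (μ := bernoulliMeasure true false p)
    (ν := bernoulliMeasure true false ⟨1 / 2, by norm_num, by norm_num⟩)).comp
    (measurePreserving_snd
      (μ := Measure.pi fun _ : Fin k => (neighborPMF G u).toMeasure))).measure_preimage
    (Set.toFinite A).measurableSet.nullMeasurableSet

lemma filter_red_card_add_filter_blue_card {k : ℕ} (x : Config n) (c : Fin k → Fin n) :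
    (Finset.univ.filter fun i => x (c i) = NodeState.red).card +
      (Finset.univ.filter fun i => x (c i) = NodeState.blue).card = k := by
  have hb : (Finset.univ.filter fun i => x (c i) = NodeState.blue) =
      Finset.univ.filter fun i => ¬ x (c i) = NodeState.red := by
    ext i
    cases h : x (c i) <;> simp [h]
  rw [hb, Finset.card_filter_add_card_filter_not, Finset.card_univ, Fintype.card_fin]

/-- Turning red needs a red majority or a tie, hence at least half of the sample red; corruption can
only help. -/
lemma choicesLaw_updateState_red_le (k : ℕ) (p : unitInterval) {x : Config n} {β : ℝ} {u : Fin n}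
    (h : FewNeighbors G x NodeState.red β) (hβ : β ≤ 1 / 2) (hu : 0 < G.degree u) :
    choicesLaw G k p u {c | updateState x c = NodeState.red} ≤
      ENNReal.ofReal (Real.exp (-2 * (1 / 2 - β) ^ 2 * k)) := by
  refine le_trans (measure_mono ?_)
    ((choicesLaw_fst k p u _).trans_le (pi_neighborPMF_half_le k h hβ hu))
  intro c hc
  have hk := filter_red_card_add_filter_blue_card x c.1
  simp only [Set.mem_ofPred_eq] at hc ⊢
  have : k ≤ 2 * (Finset.univ.filter fun i => x (c.1 i) = NodeState.red).card := by
    unfold updateState at hc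
    grind
  exact_mod_cast this

/-- Turning blue needs corruption or at least half of the sample blue: a union bound. -/
lemma choicesLaw_updateState_blue_le (k : ℕ) (p : unitInterval) {x : Config n} {β : ℝ} {u : Fin n}
    (h : FewNeighbors G x NodeState.blue β) (hβ : β ≤ 1 / 2) (hu : 0 < G.degree u) :
    choicesLaw G k p u {c | updateState x c = NodeState.blue} ≤
      ENNReal.ofReal (p + Real.exp (-2 * (1 / 2 - β) ^ 2 * k)) := by
  have hp : choicesLaw G k p u {c | c.2.1 ∈ ({true} : Set Bool)} = ENNReal.ofReal p := by
    rw [choicesLaw_corruption, ← ofReal_measureReal, bernoulliMeasure_real_apply_of_mem_of_notMem]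
    all_goals simp
  rw [ENNReal.ofReal_add p.2.1 (Real.exp_pos _).le, ← hp]
  refine le_trans (measure_mono ?_) ((measure_union_le _ _).trans (add_le_add le_rfl
    ((choicesLaw_fst k p u _).trans_le (pi_neighborPMF_half_le k h hβ hu))))
  intro c hc
  have hk := filter_red_card_add_filter_blue_card x c.1
  simp only [Set.mem_ofPred_eq, Set.mem_union, Set.mem_singleton_iff] at hc ⊢
  have : c.2.1 = true ∨
      k ≤ 2 * (Finset.univ.filter fun i => x (c.1 i) = NodeState.blue).card := by
    unfold updateState at hc
    grind
  exact_mod_cast this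

/-- Only uncorrupted nodes can stay red. For `k = 0` the empty sample is a tie, hence an inequality.
-/
lemma choicesLaw_updateState_allRed_red_le (k : ℕ) (p : unitInterval) (u : Fin n) :
    choicesLaw G k p u {c | updateState (allRed n) c = NodeState.red} ≤
      ENNReal.ofReal (1 - p) := by
  have hp : choicesLaw G k p u {c | c.2.1 ∈ ({false} : Set Bool)} = ENNReal.ofReal (1 - p) := by
    rw [choicesLaw_corruption, ← ofReal_measureReal, bernoulliMeasure_real_apply_of_notMem_of_mem]
    all_goals simp
  rw [← hp]
  refine measure_mono fun c hc => ?_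
  simp only [Set.mem_ofPred_eq, Set.mem_singleton_iff] at hc ⊢
  unfold updateState at hc
  grind

end Sample

/-! ### One round: concentration over all neighbourhoods. -/

section Step

variable {n : ℕ} {G : SimpleGraph (Fin n)} [DecidableRel G.Adj]

instance (k : ℕ) (p : unitInterval) : IsProbabilityMeasure (law G k p) := by
  unfold law
  infer_instance

lemma law_eval (k : ℕ) (p : unitInterval) (i : ℕ × Fin n) (A : Set (Choices n k)) :
    law G k p {ω | ω i ∈ A} = choicesLaw G k p i.2 A :=
  (measurePreserving_eval_infinitePi (fun i : ℕ × Fin n => choicesLaw G k p i.2) i).measure_preimage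
    (Set.toFinite A).measurableSet.nullMeasurableSet

/-- The choices in round `t`, applied to a fixed configuration, rarely leave some node with many
neighbours in state `s`. -/
lemma law_not_fewNeighbors_update_le (k : ℕ) (p : unitInterval) (x : Config n) (s : NodeState)
    (t : ℕ) {q ε : ℝ} (hq : 0 ≤ q) (hε : 0 ≤ ε)
    (hx : ∀ u, choicesLaw G k p u {c | updateState x c = s} ≤ ENNReal.ofReal q) :
    law G k p {ω | ¬ FewNeighbors G (fun u => updateState x (ω (t, u))) s (q + ε)} ≤
      ENNReal.ofReal (n * Real.exp (-2 * ε ^ 2 * G.minDegree)) := by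
  set f : Choices n k → ℝ := Set.indicator {c | updateState x c = s} 1 with hf
  have hfm : Measurable f := measurable_of_finite f
  -- Since `x` is fixed, the new state of `v` depends on the choices at `(t, v)` alone.
  have hind : iIndepFun (fun (v : Fin n) (ω : ℕ × Fin n → Choices n k) => f (ω (t, v)))
      (law G k p) :=
    (iIndepFun_infinitePi (P := fun i : ℕ × Fin n => choicesLaw G k p i.2) (X := fun _ => f)
      fun _ => hfm).precomp (g := fun v : Fin n => (t, v)) (Prod.mk_right_injective t)
  have hmean (v : Fin n) : ∫ ω, f (ω (t, v)) ∂(law G k p) ≤ q := by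
    have hmeas : Measurable fun ω : ℕ × Fin n → Choices n k => ω (t, v) := measurable_pi_apply _
    rw [← integral_map (φ := fun ω : ℕ × Fin n → Choices n k => ω (t, v)) hmeas.aemeasurable
      hfm.aestronglyMeasurable, hf, integral_indicator_one (Set.toFinite _).measurableSet,
      measureReal_def, Measure.map_apply hmeas (Set.toFinite _).measurableSet]
    exact ENNReal.toReal_le_of_le_ofReal hq ((law_eval k p (t, v) _).trans_le (hx v))
  have hnode (u : Fin n) : law G k p {ω | (q + ε) * (G.neighborFinset u).card ≤
      ∑ v ∈ G.neighborFinset u, f (ω (t, v))} ≤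
      ENNReal.ofReal (Real.exp (-2 * ε ^ 2 * G.minDegree)) := by
    refine (measure_le_sum_le_exp hind (fun v => hfm.comp (measurable_pi_apply _))
      (fun v ω => ?_) _ (fun v _ => hmean v) hε).trans
      (ENNReal.ofReal_le_ofReal (Real.exp_le_exp.2 ?_))
    · by_cases h : updateState x (ω (t, v)) = s <;> simp [hf, h]
    · have : (G.minDegree : ℝ) ≤ G.degree u := by exact_mod_cast G.minDegree_le_degree u
      rw [SimpleGraph.card_neighborFinset_eq_degree]
      nlinarith [sq_nonneg ε]
  calc law G k p {ω | ¬ FewNeighbors G (fun u => updateState x (ω (t, u))) s (q + ε)}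
      ≤ law G k p (⋃ u, {ω | (q + ε) * (G.neighborFinset u).card ≤
          ∑ v ∈ G.neighborFinset u, f (ω (t, v))}) := by
        refine measure_mono fun ω hω => ?_
        simp only [FewNeighbors, Set.mem_ofPred_eq, not_forall, not_le] at hω
        obtain ⟨u, hu⟩ := hω
        refine Set.mem_iUnion.2 ⟨u, ?_⟩
        simp only [Set.mem_ofPred_eq, SimpleGraph.card_neighborFinset_eq_degree]
        refine hu.le.trans (le_of_eq ?_)
        simp [hf, Set.indicator_apply]
    _ ≤ ∑ _u : Fin n, ENNReal.ofReal (Real.exp (-2 * ε ^ 2 * G.minDegree)) :=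
        (measure_iUnion_fintype_le _ _).trans (Finset.sum_le_sum fun u _ => hnode u)
    _ = _ := by
        rw [Finset.sum_const, Finset.card_univ, Fintype.card_fin, nsmul_eq_mul,
          ENNReal.ofReal_mul (by positivity), ENNReal.ofReal_natCast]

/-! ### Independence of rounds and the Markov property. -/

/-- The σ-algebra generated by the choices in the rounds belonging to `T`. -/
abbrev roundsSigma (n k : ℕ) (T : Set ℕ) : MeasurableSpace (ℕ × Fin n → Choices n k) :=
  ⨆ i ∈ {i : ℕ × Fin n | i.1 ∈ T}, MeasurableSpace.comap (fun ω => ω i) inferInstance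

lemma roundsSigma_mono {k : ℕ} {S T : Set ℕ} (h : S ⊆ T) :
    roundsSigma n k S ≤ roundsSigma n k T :=
  biSup_mono fun _ hi => h hi

lemma roundsSigma_le (k : ℕ) (T : Set ℕ) : roundsSigma n k T ≤ MeasurableSpace.pi :=
  iSup₂_le fun i _ => (measurable_pi_apply i).comap_le

lemma measurableSet_roundsSigma {k : ℕ} {T : Set ℕ} {t : ℕ} (ht : t ∈ T) (u : Fin n)
    (A : Set (Choices n k)) : MeasurableSet[roundsSigma n k T] {ω | ω (t, u) ∈ A} := by
  have : MeasurableSpace.comap (fun ω : ℕ × Fin n → Choices n k => ω (t, u)) inferInstance ≤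
      roundsSigma n k T := le_iSup₂_of_le (t, u) ht le_rfl
  exact this _ ⟨A, (Set.toFinite A).measurableSet, rfl⟩

lemma measurableSet_update_eq {k : ℕ} {T : Set ℕ} {t : ℕ} (ht : t ∈ T) (x y : Config n) :
    MeasurableSet[roundsSigma n k T]
      {ω : ℕ × Fin n → Choices n k | (fun u => updateState x (ω (t, u))) = y} := by
  have : {ω : ℕ × Fin n → Choices n k | (fun u => updateState x (ω (t, u))) = y} =
      ⋂ u, {ω | ω (t, u) ∈ {c | updateState x c = y u}} := by
    ext ω
    simp [funext_iff]
  rw [this]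
  exact MeasurableSet.iInter fun u => measurableSet_roundsSigma ht u _

instance : Finite NodeState :=
  Finite.of_injective (fun s => decide (s = NodeState.red)) fun a b => by
    cases a <;> cases b <;> simp

lemma measurableSet_update_mem {k : ℕ} {T : Set ℕ} {t : ℕ} (ht : t ∈ T) (x : Config n)
    (A : Set (Config n)) :
    MeasurableSet[roundsSigma n k T]
      {ω : ℕ × Fin n → Choices n k | (fun u => updateState x (ω (t, u))) ∈ A} := by
  have : {ω : ℕ × Fin n → Choices n k | (fun u => updateState x (ω (t, u))) ∈ A} =
      ⋃ y ∈ A, {ω | (fun u => updateState x (ω (t, u))) = y} := by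
    ext ω
    simp
  rw [this]
  exact MeasurableSet.biUnion (Set.toFinite A).countable fun y _ => measurableSet_update_eq ht x y

/-- The configuration at round `t` uses only rounds strictly before `t`; the induction splits over
the finitely many previous configurations. -/
lemma measurableSet_config_eq (k : ℕ) (x₀ : Config n) (t : ℕ) (y : Config n) :
    MeasurableSet[roundsSigma n k (Set.Iio t)]
      {ω : ℕ × Fin n → Choices n k | config x₀ ω t = y} := by
  induction t generalizing y with
  | zero =>
    exact @MeasurableSet.const _ (roundsSigma n k (Set.Iio 0)) (x₀ = y)
  | succ t ih =>
    have : {ω : ℕ × Fin n → Choices n k | config x₀ ω (t + 1) = y} =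
        ⋃ x, ({ω | config x₀ ω t = x} ∩ {ω | (fun u => updateState x (ω (t, u))) = y}) := by
      ext ω
      simp [config]
    rw [this]
    exact MeasurableSet.iUnion fun x => MeasurableSet.inter
      (roundsSigma_mono (Set.Iio_subset_Iio t.le_succ) _ (ih x))
      (measurableSet_update_eq (Set.mem_Iio.2 t.lt_succ_self) x y)

lemma indep_roundsSigma (k : ℕ) (p : unitInterval) {S T : Set ℕ} (h : Disjoint S T) :
    Indep (roundsSigma n k S) (roundsSigma n k T) (law G k p) := by
  refine indep_iSup_of_disjoint (fun i => (measurable_pi_apply i).comap_le) ?_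
    (Set.disjoint_left.2 fun i hS hT => Set.disjoint_left.1 h hS hT)
  exact (iIndepFun_iff_iIndep _ _ _).1 (iIndepFun_infinitePi
    (P := fun i : ℕ × Fin n => choicesLaw G k p i.2) (X := fun _ c => c) fun _ => measurable_id)

/-- **Markov property**: a bound, uniform over the configurations `x ∈ A`, on the probability that
one round leads from `x` to `B` holds for the process at round `t`. -/
lemma law_config_mem_inter_le (k : ℕ) (p : unitInterval) (x₀ : Config n) (t : ℕ)
    (A B : Set (Config n)) {a : ℝ≥0∞}
    (h : ∀ x ∈ A, law G k p {ω | (fun u => updateState x (ω (t, u))) ∈ B} ≤ a) :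
    law G k p {ω | config x₀ ω t ∈ A ∧ config x₀ ω (t + 1) ∈ B} ≤ a := by
  classical
  have := Fintype.ofFinite (Config n)
  calc law G k p {ω | config x₀ ω t ∈ A ∧ config x₀ ω (t + 1) ∈ B}
      ≤ law G k p (⋃ x ∈ A.toFinset, ({ω | config x₀ ω t = x} ∩
          {ω | (fun u => updateState x (ω (t, u))) ∈ B})) := by
        refine measure_mono fun ω hω => ?_
        simp only [Set.mem_iUnion]
        exact ⟨config x₀ ω t, by simpa using hω.1, rfl, hω.2⟩
    _ ≤ ∑ x ∈ A.toFinset, law G k p ({ω | config x₀ ω t = x} ∩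
          {ω | (fun u => updateState x (ω (t, u))) ∈ B}) := measure_biUnion_finset_le _ _
    _ ≤ ∑ x ∈ A.toFinset, law G k p {ω | config x₀ ω t = x} * a := by
        refine Finset.sum_le_sum fun x hx => ?_
        -- The past (rounds `< t`) is independent of round `t`, so the probability factors.
        rw [(Indep_iff _ _ _).1 (indep_roundsSigma k p (S := Set.Iio t) (T := {t}) (by simp)) _ _
          (measurableSet_config_eq k x₀ t x) (measurableSet_update_mem (Set.mem_singleton t) x B)]
        gcongr
        exact h x (by simpa using hx)
    _ ≤ 1 * a := by
        rw [← Finset.sum_mul]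
        gcongr
        have := sum_measure_preimage_singleton (μ := law G k p) (f := fun ω => config x₀ ω t)
          A.toFinset fun x _ => roundsSigma_le k _ _ (measurableSet_config_eq k x₀ t x)
        exact this.trans_le prob_le_one
    _ = a := one_mul a

end Step

/-! ### Bounds along the trajectory started from all red. -/

section Rounds

variable {n : ℕ} {G : SimpleGraph (Fin n)} [DecidableRel G.Adj]

lemma law_not_fewNeighbors_red_one_le (k : ℕ) (p : unitInterval) {ε : ℝ} (hε : 0 ≤ ε) :
    law G k p {ω | ¬ FewNeighbors G (config (allRed n) ω 1) NodeState.red (1 - p + ε)} ≤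
      ENNReal.ofReal (n * Real.exp (-2 * ε ^ 2 * G.minDegree)) :=
  law_not_fewNeighbors_update_le k p (allRed n) NodeState.red 0 (by linarith [p.2.2]) hε
    fun u => choicesLaw_updateState_allRed_red_le k p u

lemma law_fewNeighbors_red_step_le (k : ℕ) (p : unitInterval) (x₀ : Config n) (t : ℕ)
    {β η ε : ℝ} (hβ : β ≤ 1 / 2) (hk : Real.exp (-2 * (1 / 2 - β) ^ 2 * k) ≤ η) (hε : 0 ≤ ε)
    (hG : 0 < G.minDegree) :
    law G k p {ω | FewNeighbors G (config x₀ ω t) NodeState.red β ∧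
        ¬ FewNeighbors G (config x₀ ω (t + 1)) NodeState.red (η + ε)} ≤
      ENNReal.ofReal (n * Real.exp (-2 * ε ^ 2 * G.minDegree)) :=
  law_config_mem_inter_le k p x₀ t {x | FewNeighbors G x NodeState.red β}
    {x | ¬ FewNeighbors G x NodeState.red (η + ε)} fun x hx =>
      law_not_fewNeighbors_update_le k p x _ t ((Real.exp_pos _).le.trans hk) hε fun u =>
        (choicesLaw_updateState_red_le k p hx hβ (hG.trans_le (G.minDegree_le_degree u))).trans
          (ENNReal.ofReal_le_ofReal hk)

lemma law_fewNeighbors_blue_step_le (k : ℕ) (p : unitInterval) (x₀ : Config n) (t : ℕ)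
    {β η ε : ℝ} (hβ : β ≤ 1 / 2) (hk : Real.exp (-2 * (1 / 2 - β) ^ 2 * k) ≤ η) (hε : 0 ≤ ε)
    (hG : 0 < G.minDegree) :
    law G k p {ω | FewNeighbors G (config x₀ ω t) NodeState.blue β ∧
        ¬ FewNeighbors G (config x₀ ω (t + 1)) NodeState.blue (p + η + ε)} ≤
      ENNReal.ofReal (n * Real.exp (-2 * ε ^ 2 * G.minDegree)) :=
  law_config_mem_inter_le k p x₀ t {x | FewNeighbors G x NodeState.blue β}
    {x | ¬ FewNeighbors G x NodeState.blue (p + η + ε)} fun x hx =>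
      law_not_fewNeighbors_update_le k p x _ t
        (add_nonneg p.2.1 ((Real.exp_pos _).le.trans hk)) hε fun u =>
        (choicesLaw_updateState_blue_le k p hx hβ (hG.trans_le (G.minDegree_le_degree u))).trans
          (ENNReal.ofReal_le_ofReal (by linarith))

lemma law_not_fewNeighbors_red_two_le (k : ℕ) (p : unitInterval) {η ε ε' : ℝ}
    (hp : 1 - p + ε ≤ 1 / 2) (hk : Real.exp (-2 * (1 / 2 - (1 - p + ε)) ^ 2 * k) ≤ η)
    (hε : 0 ≤ ε) (hε' : 0 ≤ ε') (hG : 0 < G.minDegree) :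
    law G k p {ω | ¬ FewNeighbors G (config (allRed n) ω 2) NodeState.red (η + ε')} ≤
      ENNReal.ofReal (n * Real.exp (-2 * ε ^ 2 * G.minDegree)) +
        ENNReal.ofReal (n * Real.exp (-2 * ε' ^ 2 * G.minDegree)) := by
  refine (measure_mono fun ω hω => ?_).trans ((measure_union_le _ _).trans (add_le_add
    (law_not_fewNeighbors_red_one_le k p hε)
    (law_fewNeighbors_red_step_le k p (allRed n) 1 hp hk hε' hG)))
  by_cases h : FewNeighbors G (config (allRed n) ω 1) NodeState.red (1 - p + ε)
  · exact Or.inr ⟨h, hω⟩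
  · exact Or.inl h

/-- A small blue minority persists for `T` rounds, up to an error linear in `T`. -/
lemma law_exists_not_fewNeighbors_blue_le (k : ℕ) (p : unitInterval) {β η ε : ℝ}
    (hβ : β ≤ 1 / 2) (hk : Real.exp (-2 * (1 / 2 - β) ^ 2 * k) ≤ η) (hε : 0 ≤ ε)
    (hsum : p + η + ε = β) (hG : 0 < G.minDegree) (T : ℕ) :
    law G k p {ω | ∃ t ≤ T, ¬ FewNeighbors G (config (allRed n) ω t) NodeState.blue β} ≤
      T * ENNReal.ofReal (n * Real.exp (-2 * ε ^ 2 * G.minDegree)) := by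
  have hη : 0 ≤ η := (Real.exp_pos _).le.trans hk
  have hβ0 : 0 ≤ β := by linarith [p.2.1]
  induction T with
  | zero =>
    have : {ω : ℕ × Fin n → Choices n k |
        ∃ t ≤ 0, ¬ FewNeighbors G (config (allRed n) ω t) NodeState.blue β} = ∅ := by
      ext ω
      simp only [nonpos_iff_eq_zero, exists_eq_left, Set.mem_ofPred_eq, Set.mem_empty_iff_false,
        iff_false, not_not]
      exact fewNeighbors_allRed_blue hβ0
    rw [this, measure_empty]
    exact zero_le
  | succ T ih =>
    have step := law_fewNeighbors_blue_step_le k p (allRed n) T hβ hk hε hG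
    -- Here the bound closes up: one round from level `β` returns to level `p + η + ε = β`.
    rw [hsum] at step
    push_cast
    rw [add_mul, one_mul]
    refine (measure_mono fun ω hω => ?_).trans ((measure_union_le _ _).trans (add_le_add ih step))
    obtain ⟨t, ht, hbad⟩ := hω
    by_cases h : FewNeighbors G (config (allRed n) ω T) NodeState.blue β
    · rcases ht.lt_or_eq with ht | rfl
      · exact Or.inl ⟨t, Nat.lt_succ_iff.1 ht, hbad⟩
      · exact Or.inr ⟨h, hbad⟩
    · exact Or.inl ⟨T, le_rfl, h⟩

end Rounds

/-! ### Reading off the disruption time. -/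

section DisruptionTime

variable {n : ℕ} {G : SimpleGraph (Fin n)} [DecidableRel G.Adj]

lemma disruptionTime_eq_one {x : ℕ → Config n} (h0 : x 0 = allRed n)
    (h1 : 1 / 2 < blueFraction G (x 1)) : disruptionTime G x = 1 := by
  refine le_antisymm (iInf₂_le 1 h1) (le_iInf₂ fun t ht => ?_)
  rcases t.eq_zero_or_pos with rfl | hpos
  · rw [h0, blueFraction_allRed] at ht
    norm_num at ht
  · exact_mod_cast hpos

lemma lt_disruptionTime {x : ℕ → Config n} {T : ℕ}
    (h : ∀ t ≤ T, blueFraction G (x t) ≤ 1 / 2) : (T : ℕ∞) < disruptionTime G x := by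
  refine lt_of_lt_of_le (b := ((T + 1 : ℕ) : ℕ∞)) (by exact_mod_cast T.lt_succ_self)
    (le_iInf₂ fun t ht => ?_)
  by_contra! hlt
  exact absurd (h t (Nat.lt_succ_iff.1 (by exact_mod_cast hlt))) (not_le.2 ht)

end DisruptionTime

/-- Subadditivity alone gives `1 ≤ μ (S n) + e n`, so no measurability of the events is needed. -/
lemma tendsto_measure_one_of_compl_le {Ω : ℕ → Type*} [∀ n, MeasurableSpace (Ω n)]
    (μ : ∀ n, Measure (Ω n)) [∀ n, IsProbabilityMeasure (μ n)] {S B : ∀ n, Set (Ω n)}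
    {e : ℕ → ℝ≥0∞} (hS : ∀ᶠ n in atTop, (S n)ᶜ ⊆ B n) (hB : ∀ᶠ n in atTop, μ n (B n) ≤ e n)
    (he : Tendsto e atTop (𝓝 0)) : Tendsto (fun n => μ n (S n)) atTop (𝓝 1) := by
  have hlim : Tendsto (fun n => 1 - e n) atTop (𝓝 1) := by
    simpa using ENNReal.Tendsto.sub tendsto_const_nhds he (Or.inl ENNReal.one_ne_top)
  refine tendsto_of_tendsto_of_tendsto_of_le_of_le' hlim tendsto_const_nhds ?_
    (Eventually.of_forall fun n => prob_le_one)
  filter_upwards [hS, hB] with n hSn hBn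
  rw [tsub_le_iff_right, ← measure_univ (μ := μ n), ← Set.union_compl_self (S n)]
  exact (measure_union_le _ _).trans (add_le_add le_rfl ((measure_mono hSn).trans hBn))

/-! ### The limit of large `n`. -/

section Asymptotics

variable {G : (n : ℕ) → SimpleGraph (Fin n)} [∀ n, DecidableRel (G n).Adj]

lemma SufficientlyDense.eventually_minDegree_pos (hG : SufficientlyDense G) :
    ∀ᶠ n in atTop, 0 < (G n).minDegree := by
  filter_upwards [hG.bound one_pos, eventually_ge_atTop 2] with n hn h2
  have hlog : 0 < Real.log n := Real.log_pos (by exact_mod_cast h2)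
  have : (0 : ℝ) < (G n).minDegree := by
    rw [Real.norm_of_nonneg hlog.le, one_mul, Real.norm_of_nonneg (by positivity)] at hn
    linarith
  exact_mod_cast this

lemma SufficientlyDense.tendsto_error (hG : SufficientlyDense G) {ε K : ℝ} (hε : 0 < ε)
    (hK : 0 ≤ K) :
    Tendsto (fun n : ℕ => ENNReal.ofReal ((n : ℝ) ^ K *
      (n * Real.exp (-2 * ε ^ 2 * (G n).minDegree)))) atTop (𝓝 0) := by
  rw [← ENNReal.ofReal_zero]
  refine ENNReal.tendsto_ofReal (squeeze_zero' (Eventually.of_forall fun n => by positivity) ?_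
    tendsto_inv_atTop_nhds_zero_nat)
  -- This constant gives `(K + 2) log n ≤ 2 ε² δ_min`: `K` absorbs `n ^ K`, one unit absorbs the
  -- factor `n`, and one is left for the decay `1 / n`.
  filter_upwards [hG.bound (c := 2 * ε ^ 2 / (K + 2)) (by positivity), eventually_ge_atTop 1]
    with n hn h1
  have hn0 : (0 : ℝ) < n := by exact_mod_cast h1
  have hlog : 0 ≤ Real.log n := Real.log_nonneg (by exact_mod_cast h1)
  rw [Real.norm_of_nonneg hlog, Real.norm_of_nonneg (by positivity), div_mul_eq_mul_div,
    le_div_iff₀ (by positivity)] at hn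
  calc (n : ℝ) ^ K * (n * Real.exp (-2 * ε ^ 2 * (G n).minDegree))
      = Real.exp (Real.log n * K) *
        (Real.exp (Real.log n) * Real.exp (-2 * ε ^ 2 * (G n).minDegree)) := by
        rw [Real.rpow_def_of_pos hn0, Real.exp_log hn0]
    _ = Real.exp (Real.log n * K + (Real.log n + -2 * ε ^ 2 * (G n).minDegree)) := by
        rw [Real.exp_add, Real.exp_add]
    _ ≤ Real.exp (-Real.log n) := Real.exp_le_exp.2 (by linarith)
    _ = (n : ℝ)⁻¹ := by rw [Real.exp_neg, Real.exp_log hn0]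

lemma SufficientlyDense.tendsto_error_zero (hG : SufficientlyDense G) {ε : ℝ} (hε : 0 < ε) :
    Tendsto (fun n : ℕ => ENNReal.ofReal (n * Real.exp (-2 * ε ^ 2 * (G n).minDegree)))
      atTop (𝓝 0) := by
  simpa using hG.tendsto_error hε le_rfl

theorem tendsto_law_disruptionTime_eq_one (hG : SufficientlyDense G) (k : ℕ) {p : unitInterval}
    (hp : (1 / 2 : ℝ) < p) :
    Tendsto (fun n => law (G n) k p {ω | disruptionTime (G n) (config (allRed n) ω) = 1})
      atTop (𝓝 1) := by
  -- Half of the gap, so that `1 - p + ε = 1/2 - ε` is still below `1/2`.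
  have hε : 0 < ((p : ℝ) - 1 / 2) / 2 := by linarith
  refine tendsto_measure_one_of_compl_le (fun n => law (G n) k p) ?_
    (Eventually.of_forall fun n => law_not_fewNeighbors_red_one_le k p hε.le)
    (hG.tendsto_error_zero hε)
  filter_upwards [hG.eventually_minDegree_pos, eventually_gt_atTop 0] with n hd hn ω hω hfew
  refine hω (disruptionTime_eq_one rfl ?_)
  have := FewNeighbors.le_blueFraction (vol_univ_pos hn hd) hfew
  linarith

/-- The budget `γ` is split evenly between the sampling error, made small by `k`, and the
fluctuation in round 2. -/
theorem tendsto_law_le_blueFraction_two (hG : SufficientlyDense G) (k : ℕ) {p : unitInterval}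
    (hp : (1 / 2 : ℝ) < p) {γ : ℝ} (hγ : 0 < γ)
    (hk : Real.exp (-2 * (((p : ℝ) - 1 / 2) / 2) ^ 2 * k) ≤ γ / 2) :
    Tendsto (fun n => law (G n) k p {ω | 1 - γ ≤ blueFraction (G n) (config (allRed n) ω 2)})
      atTop (𝓝 1) := by
  have hε : 0 < ((p : ℝ) - 1 / 2) / 2 := by linarith
  have hγ2 : 0 < γ / 2 := by linarith
  have hd : 1 / 2 - (1 - (p : ℝ) + ((p : ℝ) - 1 / 2) / 2) = ((p : ℝ) - 1 / 2) / 2 := by ring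
  have he := (hG.tendsto_error_zero hε).add (hG.tendsto_error_zero hγ2)
  rw [add_zero] at he
  refine tendsto_measure_one_of_compl_le (fun n => law (G n) k p) ?_
    (hG.eventually_minDegree_pos.mono fun n hn =>
      law_not_fewNeighbors_red_two_le k p (η := γ / 2) (by linarith) (by rwa [hd]) hε.le hγ2.le
        hn) he
  filter_upwards [hG.eventually_minDegree_pos, eventually_gt_atTop 0] with n hd hn ω hω hfew
  refine hω ?_
  have := FewNeighbors.le_blueFraction (vol_univ_pos hn hd) hfew
  rwa [add_halves] at this

theorem tendsto_law_rpow_lt_disruptionTime (hG : SufficientlyDense G) (k : ℕ) {p : unitInterval}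
    (hp : (p : ℝ) < 1 / 2)
    (hk : Real.exp (-2 * ((1 / 2 - (p : ℝ)) / 2) ^ 2 * k) ≤ (1 / 2 - p) / 4)
    {K : ℝ} (hK : 0 < K) :
    Tendsto (fun n => law (G n) k p {ω | (n : ℝ≥0∞) ^ K <
      (disruptionTime (G n) (config (allRed n) ω) : ℝ≥0∞)}) atTop (𝓝 1) := by
  -- The gap `(1/2 - p) / 2` between `p` and the midpoint `β` is shared equally by `η` and `ε`.
  have hε : 0 < (1 / 2 - (p : ℝ)) / 4 := by linarith
  have hβ : 1 / 2 - ((p : ℝ) + (1 / 2 - p) / 2) = (1 / 2 - p) / 2 := by ring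
  refine tendsto_measure_one_of_compl_le (fun n => law (G n) k p)
    (B := fun n => {ω | ∃ t ≤ ⌊(n : ℝ) ^ K⌋₊, ¬ FewNeighbors (G n) (config (allRed n) ω t)
      NodeState.blue ((p : ℝ) + (1 / 2 - p) / 2)}) (Eventually.of_forall fun n ω hω => ?_)
    (hG.eventually_minDegree_pos.mono fun n hn => ?_) (hG.tendsto_error hε hK.le)
  · by_contra hfew
    simp only [Set.mem_ofPred_eq, not_exists, not_and, not_not] at hfew
    refine hω ?_
    have hlt : ((⌊(n : ℝ) ^ K⌋₊ : ℕ) : ℕ∞) < disruptionTime (G n) (config (allRed n) ω) :=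
      lt_disruptionTime fun t ht =>
        ((hfew t ht).blueFraction_le (by linarith [p.2.1])).trans (by linarith)
    -- Exceeding the floor is not enough for a real bound; integrality gives floor plus one, which
    -- is above `n ^ K`.
    have hsucc : ((⌊(n : ℝ) ^ K⌋₊ + 1 : ℕ) : ℕ∞) ≤ disruptionTime (G n) (config (allRed n) ω) := by
      push_cast
      exact Order.add_one_le_of_lt hlt
    calc (n : ℝ≥0∞) ^ K = ENNReal.ofReal ((n : ℝ) ^ K) := by
          rw [← ENNReal.ofReal_rpow_of_nonneg n.cast_nonneg hK.le, ENNReal.ofReal_natCast]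
      _ < ENNReal.ofReal ((⌊(n : ℝ) ^ K⌋₊ + 1 : ℕ) : ℝ) := by
          rw [ENNReal.ofReal_lt_ofReal_iff (by positivity)]
          exact_mod_cast Nat.lt_floor_add_one ((n : ℝ) ^ K)
      _ = (((⌊(n : ℝ) ^ K⌋₊ + 1 : ℕ) : ℕ∞) : ℝ≥0∞) := by
          rw [ENNReal.ofReal_natCast, ENat.toENNReal_coe]
      _ ≤ (disruptionTime (G n) (config (allRed n) ω) : ℝ≥0∞) := ENat.toENNReal_le.2 hsucc
  · refine (law_exists_not_fewNeighbors_blue_le k p (η := (1 / 2 - p) / 4) (by linarith)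
      (by rwa [hβ]) hε.le (by ring) hn _).trans ?_
    rw [ENNReal.ofReal_mul (p := (n : ℝ) ^ K) (by positivity), ← ENNReal.ofReal_natCast]
    gcongr
    exact Nat.floor_le (by positivity)

end Asymptotics

lemma exists_forall_exp_le {d η : ℝ} (hd : d ≠ 0) (hη : 0 < η) :
    ∃ H : ℕ, ∀ k : ℕ, H < k → Real.exp (-2 * d ^ 2 * k) ≤ η := by
  have hlim : Tendsto (fun k : ℕ => Real.exp (-2 * d ^ 2 * k)) atTop (𝓝 0) := by
    refine Real.tendsto_exp_atBot.comp
      (tendsto_natCast_atTop_atTop.const_mul_atTop_of_neg ?_)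
    have : 0 < d ^ 2 := by positivity
    linarith
  obtain ⟨H, hH⟩ := eventually_atTop.1 (hlim.eventually_le_const hη)
  exact ⟨H, fun k hk => hH k hk.le⟩

end NodeMajority

theorem mainTheorem10 (p : unitInterval) (γ : ℝ) (hγ : 0 < γ) :
    ∃ H : ℕ, ∀ (G : (n : ℕ) → SimpleGraph (Fin n)) [∀ n, DecidableRel (G n).Adj],
      NodeMajority.SufficientlyDense G →
      ((1 / 2 : ℝ) < p → ∀ k : ℕ, H < k →
        Tendsto (fun n => NodeMajority.law (G n) k p
          {ω | NodeMajority.disruptionTime (G n)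
            (NodeMajority.config (NodeMajority.allRed n) ω) = 1}) atTop (𝓝 1) ∧
        Tendsto (fun n => NodeMajority.law (G n) k p
          {ω | 1 - γ ≤ NodeMajority.blueFraction (G n)
            (NodeMajority.config (NodeMajority.allRed n) ω 2)}) atTop (𝓝 1)) ∧
      ((p : ℝ) < 1 / 2 → ∀ k : ℕ, H < k → ∀ K : ℝ, 0 < K →
        Tendsto (fun n => NodeMajority.law (G n) k p
          {ω | (n : ℝ≥0∞) ^ K < (NodeMajority.disruptionTime (G n)
            (NodeMajority.config (NodeMajority.allRed n) ω) : ℝ≥0∞)}) atTop (𝓝 1)) := by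
  -- The sampling condition on `k` involves only `p` and `γ`, so `H` is uniform in the graphs; at `p
  -- = 1/2` both claims are vacuous.
  rcases lt_trichotomy (p : ℝ) (1 / 2) with hp | hp | hp
  · obtain ⟨H, hH⟩ := NodeMajority.exists_forall_exp_le (d := (1 / 2 - (p : ℝ)) / 2)
      (η := (1 / 2 - p) / 4) (by linarith) (by linarith)
    exact ⟨H, fun G _ hG => ⟨fun h => absurd h hp.not_gt, fun _ k hk K hK =>
      NodeMajority.tendsto_law_rpow_lt_disruptionTime hG k hp (hH k hk) hK⟩⟩
  · exact ⟨0, fun G _ _ => ⟨fun h => absurd h hp.le.not_gt, fun h => absurd h hp.ge.not_gt⟩⟩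
  · obtain ⟨H, hH⟩ := NodeMajority.exists_forall_exp_le (d := ((p : ℝ) - 1 / 2) / 2)
      (η := γ / 2) (by linarith) (by linarith)
    exact ⟨H, fun G _ hG => ⟨fun _ k hk =>
      ⟨NodeMajority.tendsto_law_disruptionTime_eq_one hG k hp,
        NodeMajority.tendsto_law_le_blueFraction_two hG k hp hγ (hH k hk)⟩,
      fun h => absurd h hp.not_gt⟩⟩
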